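/- Let $n\ge 3$, let $B_1$ be the open unit ball of $\mathbb R^n$, and write $\Delta=-\sum_{j=1}^n\partial_{jj}$ for the geometric Laplacian. Let $a,b,c,d>0$ and let $(A_i)_{i\in\mathbb N}$, $(B_i)_{i\in\mathbb N}$ be real sequences with $A_i\to 0$ and $B_i\to 0$. Then there exist a constant $C>0$ and an index $i_0$, depending only on $n,a,b,c,d,(A_i),(B_i)$, such that the following holds. For each $i$ let $V_i$ and $W_i$ be radial functions on $B_1$, written as functions of $r=|x|\in[0,1)$, with $$a\le V_i(r)\le b,\qquad |V_i(r)-V_i(r')|\le A_i\,|r^2-r'^2|\qquad (r,r'\in[0,1)),$$ $$c\le W_i(r)\le d\quad (r\in[0,1)),\qquad |W_i'(r)|\le B_i\quad (r\in(0,1)),$$ where $W_i$ is continuous on $[0,1)$ and differentiable on $(0,1)$. Let $u_i$ be a radial function, also written as a function of $r=|x|$, which is continuous on $\overline{B_1}$, of class $C^2$ and positive on $B_1$, and solves $$\Delta u_i=V_i\,u_i^{(n+2)/(n-2)}+W_i\,u_i\qquad\text{in } B_1 .$$ Then $$u_i(0)\,u_i(1)\le C\qquad\text{for all } i\ge i_0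 .$$ -/

import Mathlib

/-- `HasCondV a b A V`: the radial profile `V` on `[0, 1)` satisfies `a ≤ V(r) ≤ b` and
`|V(r) - V(r')| ≤ A |r² - r'²|`. -/
structure HasCondV (a b A : ℝ) (V : ℝ → ℝ) : Prop where
  bounds : ∀ r ∈ Set.Ico (0 : ℝ) 1, a ≤ V r ∧ V r ≤ b
  lip : ∀ r ∈ Set.Ico (0 : ℝ) 1, ∀ r' ∈ Set.Ico (0 : ℝ) 1,
    |V r - V r'| ≤ A * |r ^ 2 - r' ^ 2|

/-- `HasCondW c d B W`: the radial profile `W` is continuous on `[0, 1)`, differentiable on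
`(0, 1)`, and satisfies `c ≤ W(r) ≤ d` and `|W'(r)| ≤ B`. -/
structure HasCondW (c d B : ℝ) (W : ℝ → ℝ) : Prop where
  bounds : ∀ r ∈ Set.Ico (0 : ℝ) 1, c ≤ W r ∧ W r ≤ d
  cont : ContinuousOn W (Set.Ico 0 1)
  diff : DifferentiableOn ℝ W (Set.Ioo 0 1)
  deriv_le : ∀ r ∈ Set.Ioo (0 : ℝ) 1, |deriv W r| ≤ B

/-- `IsRadialSolution n V W u`: the radial function `x ↦ u(|x|)` is continuous on the closed unit
ball of `ℝⁿ`, is `C²` and positive on the open unit ball, and solves there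
`-∑ ∂ᵢᵢ u = V u^((n+2)/(n-2)) + W u`, with `V`, `W` the radial functions of profiles `V`, `W`. -/
structure IsRadialSolution (n : ℕ) (V W u : ℝ → ℝ) : Prop where
  cont : ContinuousOn (fun x : EuclideanSpace ℝ (Fin n) => u ‖x‖) (Metric.closedBall 0 1)
  smooth : ContDiffOn ℝ 2 (fun x : EuclideanSpace ℝ (Fin n) => u ‖x‖) (Metric.ball 0 1)
  pos : ∀ x ∈ Metric.ball (0 : EuclideanSpace ℝ (Fin n)) 1, 0 < u ‖x‖
  eqn : ∀ x ∈ Metric.ball (0 : EuclideanSpace ℝ (Fin n)) 1,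
    - Laplacian.laplacian (fun y : EuclideanSpace ℝ (Fin n) => u ‖y‖) x
      = V ‖x‖ * u ‖x‖ ^ (((n : ℝ) + 2) / ((n : ℝ) - 2)) + W ‖x‖ * u ‖x‖

/-! Write `N = n - 2` and `Z = V u^(4/N)`. The logarithmic slope `y = -r u'/u` starts at `0` and
satisfies the Riccati equation `r y' = r² (Z + W) - y (N - y)`. The Pohozaev energy would be
increasing if `V` were constant, since `W + r W'/2 > 0`. The drift of `V` is absorbed by this gain
once `A_i` is small, thanks to the decay bound `r² u^(4/N) ≤ nN/(2a)` (`sq_mul_rpow_le`). Hence the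
energy is nonnegative, which says `y (N - y) ≤ r² ((N/n) Z + W)`. With the Riccati equation this
makes `y` nondecreasing, and eliminating `Z` leaves `y (N - y) ≤ (N/2) r y' + d r²`
(`deriv_decayRate_bounds`).

This last inequality integrates without any knowledge of `u`. Where `y ≤ N/2` it bounds `log u(0) -
log u(r)` (`log_zero_le`); where `y ≥ N/2` it bounds the growth of `r^N u(r)` (`log_pow_mul_le`). At
the radius where `y = N/2` the two estimates are glued by the decay bound, which controls `r^N
u(r)²`. This bounds `u(0) u(ρ)` for each `ρ < 1`, and `u(1) ≤ u(ρ)`. -/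

open Set Filter Topology

/-- The radial profile of a positive solution of `-Δu = V u^((n+2)/(n-2)) + W u` on the unit ball,
with first derivative `u₁`, as a solution of the radial ordinary differential equation. -/
structure IsProfile (n : ℕ) (V W u u₁ : ℝ → ℝ) : Prop where
  cont : ContinuousOn u (Icc 0 1)
  pos : ∀ r ∈ Ico (0 : ℝ) 1, 0 < u r
  hasDerivAt : ∀ r ∈ Ioo (0 : ℝ) 1, HasDerivAt u (u₁ r) r
  hasDerivAt_deriv : ∀ r ∈ Ioo (0 : ℝ) 1, HasDerivAt u₁
    (-(((n : ℝ) - 1) / r * u₁ r) - (V r * u r ^ (((n : ℝ) + 2) / ((n : ℝ) - 2)) + W r * u r)) r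
  tendsto_deriv : Tendsto u₁ (𝓝[>] 0) (𝓝 0)

/-! ### Reduction of the equation on the ball to the radial ODE. -/

section Radial

variable {E : Type*} [NormedAddCommGroup E] [InnerProductSpace ℝ E]

lemma hasDerivAt_comp_line {F : Type*} [NormedAddCommGroup F] [NormedSpace ℝ F] {f : E → F}
    {x v : E} {s : ℝ} (hf : DifferentiableAt ℝ f (x + s • v)) :
    HasDerivAt (fun t : ℝ => f (x + t • v)) (fderiv ℝ f (x + s • v) v) s := by
  have h : HasDerivAt (fun t : ℝ => x + t • v) v s := by
    simpa using ((hasDerivAt_id s).smul_const v).const_add x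
  exact hf.hasFDerivAt.comp_hasDerivAt s h

lemma ContDiffOn.differentiableAt_ball {f : E → ℝ} (hf : ContDiffOn ℝ 2 f (Metric.ball 0 1))
    {x : E} (hx : ‖x‖ < 1) : DifferentiableAt ℝ f x :=
  (hf.contDiffAt (Metric.isOpen_ball.mem_nhds (by simpa using hx))).differentiableAt (by norm_num)

lemma ContDiffOn.differentiableAt_fderiv_ball {f : E → ℝ}
    (hf : ContDiffOn ℝ 2 f (Metric.ball 0 1)) {x : E} (hx : ‖x‖ < 1) :
    DifferentiableAt ℝ (fderiv ℝ f) x :=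
  ((hf.contDiffAt (Metric.isOpen_ball.mem_nhds (by simpa using hx))).fderiv_right
    (m := 1) (by norm_num)).differentiableAt (by norm_num)

variable {u : ℝ → ℝ} {e v : E}

lemma norm_smul_of_unit (he : ‖e‖ = 1) {r : ℝ} (hr : 0 ≤ r) : ‖r • e‖ = r := by
  rw [norm_smul, he, mul_one, Real.norm_of_nonneg hr]

lemma norm_smul_add_smul_of_orthonormal (he : ‖e‖ = 1) (hv : ‖v‖ = 1) (hev : inner ℝ e v = 0)
    (r s : ℝ) : ‖r • e + s • v‖ = √(r ^ 2 + s ^ 2) := by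
  have h : ‖r • e + s • v‖ ^ 2 = r ^ 2 + s ^ 2 := by
    rw [norm_add_sq_real, inner_smul_left, inner_smul_right, hev, norm_smul, norm_smul, he, hv]
    simp
  rw [← h, Real.sqrt_sq (norm_nonneg _)]

lemma hasDerivAt_of_radial (hu : ContDiffOn ℝ 2 (fun x : E => u ‖x‖) (Metric.ball 0 1))
    (he : ‖e‖ = 1) {r : ℝ} (hr : r ∈ Ioo (0 : ℝ) 1) :
    HasDerivAt u (fderiv ℝ (fun x : E => u ‖x‖) (r • e) e) r := by
  have h := hasDerivAt_comp_line (f := fun x : E => u ‖x‖) (x := 0) (v := e) (s := r)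
    (hu.differentiableAt_ball (by simpa [norm_smul_of_unit he hr.1.le] using hr.2))
  simp only [zero_add] at h
  refine h.congr_of_eventuallyEq ?_
  filter_upwards [Ioi_mem_nhds hr.1] with t ht
  rw [norm_smul_of_unit he (le_of_lt ht)]

lemma hasDerivAt_fderiv_radial (hu : ContDiffOn ℝ 2 (fun x : E => u ‖x‖) (Metric.ball 0 1))
    {r : ℝ} {x : E} (hx : ‖x + r • e‖ < 1) :
    HasDerivAt (fun s : ℝ => fderiv ℝ (fun x : E => u ‖x‖) (x + s • e) e)
      (fderiv ℝ (fderiv ℝ (fun x : E => u ‖x‖)) (x + r • e) e e) r := by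
  have h := hasDerivAt_comp_line (hu.differentiableAt_fderiv_ball hx)
  simpa using h.clm_apply (hasDerivAt_const r e)

lemma tendsto_fderiv_radial (hu : ContDiffOn ℝ 2 (fun x : E => u ‖x‖) (Metric.ball 0 1)) :
    Tendsto (fun s : ℝ => fderiv ℝ (fun x : E => u ‖x‖) (s • e) e) (𝓝[>] 0) (𝓝 0) := by
  set f : E → ℝ := fun x => u ‖x‖ with hf
  have h0 : fderiv ℝ f 0 e = 0 := by
    have h1 := hasDerivAt_comp_line (f := f) (x := 0) (v := e) (s := 0)
      (hu.differentiableAt_ball (by simp))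
    have h2 := hasDerivAt_comp_line (f := f) (x := 0) (v := -e) (s := 0)
      (hu.differentiableAt_ball (by simp))
    -- Evenness along every line through the origin kills the gradient there.
    have h3 : (fun t : ℝ => f (0 + t • -e)) = fun t : ℝ => f (0 + t • e) := by
      ext t
      simp [hf]
    rw [h3] at h2
    have h4 := h1.unique h2
    simp only [zero_smul, add_zero, map_neg] at h4
    linarith
  have h1 := (hasDerivAt_fderiv_radial (u := u) (e := e) (x := 0) (r := 0) hu
    (by simp)).continuousAt.tendsto
  simp only [zero_add, zero_smul] at h1
  rw [← hf, h0] at h1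
  exact h1.mono_left nhdsWithin_le_nhds

/-- Along the tangent line `r • e + s • v` the function is `u √(r² + s²)`, whose `s`-derivative is
`s` times a quotient differentiable at `s = 0`. The second derivative at `0` is therefore the value
of that quotient, `u'(r)/r`. -/
lemma fderiv_fderiv_radial_tangential
    (hu : ContDiffOn ℝ 2 (fun x : E => u ‖x‖) (Metric.ball 0 1))
    (he : ‖e‖ = 1) (hv : ‖v‖ = 1) (hev : inner ℝ e v = 0) {r : ℝ} (hr : r ∈ Ioo (0 : ℝ) 1) :
    fderiv ℝ (fderiv ℝ (fun x : E => u ‖x‖)) (r • e) v v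
      = fderiv ℝ (fun x : E => u ‖x‖) (r • e) e / r := by
  set f : E → ℝ := fun x => u ‖x‖ with hf
  set u₁ : ℝ → ℝ := fun s => fderiv ℝ f (s • e) e with hu₁
  have hρ0 : √(r ^ 2 + 0 ^ 2) = r := by simp [Real.sqrt_sq hr.1.le]
  have hpos : ∀ s : ℝ, 0 < r ^ 2 + s ^ 2 := fun s => by have := hr.1; positivity
  have hρ : ∀ s : ℝ, HasDerivAt (fun t : ℝ => √(r ^ 2 + t ^ 2)) (s / √(r ^ 2 + s ^ 2)) s := by
    intro s
    have h := (((hasDerivAt_id s).pow 2).const_add (r ^ 2)).sqrt (hpos s).ne'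
    refine h.congr_deriv ?_
    have h0 := (Real.sqrt_pos.2 (hpos s)).ne'
    simp only [id, Pi.pow_apply]
    field_simp
    simp
  have h1 : HasDerivAt (fun s : ℝ => fderiv ℝ f (r • e + s • v) v)
      (fderiv ℝ (fderiv ℝ f) (r • e) v v) 0 := by
    have h := hasDerivAt_fderiv_radial (u := u) (e := v) (x := r • e) (r := 0) hu
      (by simpa [norm_smul_of_unit he hr.1.le] using hr.2)
    simpa using h
  have h2 : ∀ᶠ s in 𝓝 (0 : ℝ), fderiv ℝ f (r • e + s • v) v
      = s * (u₁ √(r ^ 2 + s ^ 2) / √(r ^ 2 + s ^ 2)) := by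
    have hlt : ∀ᶠ s in 𝓝 (0 : ℝ), √(r ^ 2 + s ^ 2) < 1 :=
      (hρ 0).continuousAt.eventually_lt continuousAt_const (by rw [hρ0]; exact hr.2)
    filter_upwards [hlt] with s hs
    have ha := hasDerivAt_comp_line (f := f) (x := r • e) (v := v) (s := s)
      (hu.differentiableAt_ball (by rwa [norm_smul_add_smul_of_orthonormal he hv hev]))
    have hb : HasDerivAt (fun t : ℝ => u √(r ^ 2 + t ^ 2))
        (u₁ √(r ^ 2 + s ^ 2) * (s / √(r ^ 2 + s ^ 2))) s :=
      (hasDerivAt_of_radial hu he ⟨Real.sqrt_pos.2 (hpos s), hs⟩).comp s (hρ s)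
    have hc : (fun t : ℝ => f (r • e + t • v)) = fun t : ℝ => u √(r ^ 2 + t ^ 2) := by
      ext t
      simp only [hf, norm_smul_add_smul_of_orthonormal he hv hev]
    rw [hc] at ha
    rw [ha.unique hb]
    ring
  have h3 : HasDerivAt u₁ (fderiv ℝ (fderiv ℝ f) (r • e) e e) r := by
    have h := hasDerivAt_fderiv_radial (u := u) (e := e) (x := 0) (r := r) hu
      (by simpa [norm_smul_of_unit he hr.1.le] using hr.2)
    simpa using h
  have h4 : DifferentiableAt ℝ (fun s : ℝ => u₁ √(r ^ 2 + s ^ 2) / √(r ^ 2 + s ^ 2)) 0 := by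
    refine DifferentiableAt.div ?_ (hρ 0).differentiableAt (by rw [hρ0]; exact hr.1.ne')
    have h5 : DifferentiableAt ℝ u₁ √(r ^ 2 + 0 ^ 2) := by
      rw [hρ0]
      exact h3.differentiableAt
    exact h5.comp (0 : ℝ) (hρ 0).differentiableAt
  have h6 := (hasDerivAt_id (0 : ℝ)).mul h4.hasDerivAt
  have h7 := h1.unique (h6.congr_of_eventuallyEq h2)
  rw [h7, hρ0]
  simp [hu₁]

end Radial

lemma IsRadialSolution.exists_isProfile {n : ℕ} (hn : 3 ≤ n) {V W u : ℝ → ℝ}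
    (h : IsRadialSolution n V W u) : ∃ u₁, IsProfile n V W u u₁ := by
  set b := EuclideanSpace.basisFun (Fin n) ℝ with hb
  set i₀ : Fin n := ⟨0, by omega⟩
  set f : EuclideanSpace ℝ (Fin n) → ℝ := fun x => u ‖x‖ with hf
  have he : ∀ i, ‖b i‖ = 1 := fun i => b.orthonormal.1 i
  refine ⟨fun s => fderiv ℝ f (s • b i₀) (b i₀), ?_, ?_, fun r hr =>
    hasDerivAt_of_radial h.smooth (he i₀) hr, ?_, tendsto_fderiv_radial h.smooth⟩
  · have h1 : ContinuousOn (fun r : ℝ => f (r • b i₀)) (Icc 0 1) := by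
      refine h.cont.comp (by fun_prop) fun r hr => ?_
      simpa [norm_smul_of_unit (he i₀) hr.1] using hr.2
    refine h1.congr fun r hr => ?_
    simp [hf, norm_smul_of_unit (he i₀) hr.1]
  · intro r hr
    have := h.pos (r • b i₀) (by simpa [norm_smul_of_unit (he i₀) hr.1] using hr.2)
    rwa [norm_smul_of_unit (he i₀) hr.1] at this
  · intro r hr
    have hnr := norm_smul_of_unit (he i₀) hr.1.le
    have h1 := hasDerivAt_fderiv_radial (u := u) (e := b i₀) (x := 0) (r := r) h.smooth
      (by simpa [hnr] using hr.2)
    simp only [zero_add] at h1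
    refine h1.congr_deriv ?_
    have h2 := h.eqn (r • b i₀) (by simpa [hnr] using hr.2)
    rw [InnerProductSpace.laplacian_eq_iteratedFDeriv_orthonormalBasis _ b, hnr] at h2
    simp only [iteratedFDeriv_two_apply, Matrix.cons_val_zero, Matrix.cons_val_one] at h2
    -- At `r • b i₀` one basis direction is radial; the other `n - 1` are tangential and contribute
    -- `u'/r` each.
    rw [← Finset.add_sum_erase _ _ (Finset.mem_univ i₀), Finset.sum_congr rfl
      (g := fun _ => fderiv ℝ f (r • b i₀) (b i₀) / r)] at h2
    · rw [Finset.sum_const, Finset.card_erase_of_mem (Finset.mem_univ _), Finset.card_univ,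
        Fintype.card_fin, nsmul_eq_mul, Nat.cast_sub (by omega)] at h2
      push_cast at h2
      have h3 : ((n : ℝ) - 1) / r * fderiv ℝ f (r • b i₀) (b i₀)
        = ((n : ℝ) - 1) * (fderiv ℝ f (r • b i₀) (b i₀) / r) := by ring
      rw [h3]
      linarith
    · intro i hi
      exact fderiv_fderiv_radial_tangential h.smooth (he i₀) (he i)
        (b.orthonormal.2 (Finset.ne_of_mem_erase hi).symm) hr

/-! ### Real-variable tools and the critical exponents. -/

lemma hasDerivAt_pow_of_ne_zero (m : ℕ) {r : ℝ} (hr : r ≠ 0) :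
    HasDerivAt (fun x : ℝ => x ^ m) (m / r * r ^ m) r := by
  refine (hasDerivAt_pow m r).congr_deriv ?_
  cases m with
  | zero => simp
  | succ m => field_simp; simp [pow_succ]

/-- Integration from the origin, where the radial equation is singular and only one-sided limits are
at hand. -/
lemma le_of_hasDerivAt_nonneg_of_tendsto {f f' : ℝ → ℝ} {ρ l : ℝ} (hρ : 0 < ρ)
    (hf : ∀ r ∈ Ioc 0 ρ, HasDerivAt f (f' r) r) (hf' : ∀ r ∈ Ioc 0 ρ, 0 ≤ f' r)
    (hl : Tendsto f (𝓝[>] 0) (𝓝 l)) : l ≤ f ρ := by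
  have hmono : MonotoneOn f (Ioc 0 ρ) := by
    refine monotoneOn_of_deriv_nonneg (convex_Ioc 0 ρ)
      (fun r hr => (hf r hr).continuousAt.continuousWithinAt)
      (fun r hr => (hf r (interior_subset hr)).differentiableAt.differentiableWithinAt)
      fun r hr => ?_
    rw [(hf r (interior_subset hr)).deriv]
    exact hf' r (interior_subset hr)
  refine le_of_tendsto hl ?_
  filter_upwards [Ioc_mem_nhdsGT hρ] with s hs
  exact hmono hs ⟨hρ, le_rfl⟩ hs.2

lemma HasDerivAt.eventually_lt_of_pos {f : ℝ → ℝ} {f' x : ℝ} (hf : HasDerivAt f f' x)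
    (hf' : 0 < f') : ∀ᶠ y in 𝓝[>] x, f x < f y := by
  have h := (hasDerivAt_iff_tendsto_slope.1 hf).eventually_const_lt hf'
  have h' := h.filter_mono (nhdsWithin_mono x (fun y (hy : x < y) => hy.ne'))
  filter_upwards [h', self_mem_nhdsWithin] with y hy hxy
  rw [slope_def_field, div_pos_iff_of_pos_right (sub_pos.2 hxy)] at hy
  linarith

/-- A substitute for the sign of the derivative: the Pohozaev energy contains `V`, which is
Lipschitz but need not be differentiable. -/
lemma ContinuousOn.le_of_eventually_le {f : ℝ → ℝ} {x y : ℝ} (hxy : x ≤ y)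
    (hf : ContinuousOn f (Icc x y)) (h : ∀ t ∈ Ico x y, ∀ᶠ s in 𝓝[>] t, f t ≤ f s) :
    f x ≤ f y := by
  have hcl : IsClosed ({t | f x ≤ f t} ∩ Icc x y) := by
    rw [inter_comm]
    exact hf.preimage_isClosed_of_isClosed isClosed_Icc isClosed_Ici
  refine hcl.Icc_subset_of_forall_mem_nhdsWithin (le_refl (f x)) (fun t ht => ?_)
    (right_mem_Icc.2 hxy)
  filter_upwards [h t ht.2] with s hs
  exact le_trans ht.1 hs

lemma HasCondV.continuousAt {a b A : ℝ} {V : ℝ → ℝ} (hV : HasCondV a b A V) {r : ℝ}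
    (hr : r ∈ Ioo (0 : ℝ) 1) : ContinuousAt V r := by
  have h0 : Tendsto (fun s : ℝ => A * |s ^ 2 - r ^ 2|) (𝓝 r) (𝓝 0) := by
    have h : Continuous fun s : ℝ => A * |s ^ 2 - r ^ 2| := by fun_prop
    simpa using h.tendsto r
  refine tendsto_iff_norm_sub_tendsto_zero.2 (squeeze_zero' (.of_forall fun _ => norm_nonneg _) ?_ h0)
  filter_upwards [Ioo_mem_nhds hr.1 hr.2] with s hs
  exact hV.lip s (Ioo_subset_Ico_self hs) r (Ioo_subset_Ico_self hr)

lemma HasCondW.hasDerivAt {c d B : ℝ} {W : ℝ → ℝ} (hW : HasCondW c d B W) {r : ℝ}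
    (hr : r ∈ Ioo (0 : ℝ) 1) : HasDerivAt W (deriv W r) r :=
  ((hW.diff r hr).differentiableAt (Ioo_mem_nhds hr.1 hr.2)).hasDerivAt

lemma one_le_cast_sub_two {n : ℕ} (hn : 3 ≤ n) : (1 : ℝ) ≤ (n : ℝ) - 2 := by
  have : (3 : ℝ) ≤ n := by exact_mod_cast hn
  linarith

lemma rpow_critical {n : ℕ} (hn : 3 ≤ n) {x : ℝ} (hx : 0 < x) :
    x ^ (((n : ℝ) + 2) / ((n : ℝ) - 2)) = x ^ (4 / ((n : ℝ) - 2)) * x := by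
  have h := one_le_cast_sub_two hn
  rw [← Real.rpow_add_one hx.ne']
  congr 1
  field_simp
  ring

lemma rpow_critical_add_one {n : ℕ} (hn : 3 ≤ n) {x : ℝ} (hx : 0 < x) :
    x ^ (2 * (n : ℝ) / ((n : ℝ) - 2)) = x ^ (4 / ((n : ℝ) - 2)) * x ^ 2 := by
  have h := one_le_cast_sub_two hn
  rw [pow_two, ← mul_assoc, ← Real.rpow_add_one hx.ne', ← Real.rpow_add_one hx.ne']
  congr 1
  field_simp
  ring

/-! ### Monotonicity and scale-invariant decay of the profile. -/

namespace IsProfile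

variable {n : ℕ} {V W u u₁ : ℝ → ℝ} {a b c d A B : ℝ}

lemma hasDerivAt_deriv' (hn : 3 ≤ n) (h : IsProfile n V W u u₁) {r : ℝ}
    (hr : r ∈ Ioo (0 : ℝ) 1) :
    HasDerivAt u₁ (-(((n : ℝ) - 1) / r * u₁ r)
      - (V r * u r ^ (4 / ((n : ℝ) - 2)) + W r) * u r) r := by
  refine (h.hasDerivAt_deriv r hr).congr_deriv ?_
  rw [rpow_critical hn (h.pos r (Ioo_subset_Ico_self hr))]
  ring

lemma tendsto_zero (h : IsProfile n V W u u₁) : Tendsto u (𝓝[>] 0) (𝓝 (u 0)) := by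
  have h1 := h.cont 0 (by simp)
  refine h1.mono_left (nhdsWithin_le_iff.2 ?_)
  exact mem_of_superset (Ioc_mem_nhdsGT one_pos) Ioc_subset_Icc_self

lemma hasDerivAt_flux (hn : 3 ≤ n) (h : IsProfile n V W u u₁) {r : ℝ}
    (hr : r ∈ Ioo (0 : ℝ) 1) :
    HasDerivAt (fun s => -(s ^ (n - 1) * u₁ s))
      (r ^ (n - 1) * (V r * u r ^ (4 / ((n : ℝ) - 2)) + W r) * u r) r := by
  have hr0 := hr.1.ne'
  refine ((hasDerivAt_pow_of_ne_zero (n - 1) hr0).mul (h.hasDerivAt_deriv' hn hr)).neg.congr_deriv ?_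
  rw [Nat.cast_sub (by omega)]
  push_cast
  ring

lemma tendsto_flux (h : IsProfile n V W u u₁) :
    Tendsto (fun s => s ^ (n - 1) * u₁ s) (𝓝[>] 0) (𝓝 0) := by
  have h1 : Tendsto (fun s : ℝ => s ^ (n - 1)) (𝓝[>] 0) (𝓝 (0 ^ (n - 1))) :=
    ((continuous_pow (n - 1)).tendsto 0).mono_left nhdsWithin_le_nhds
  simpa using h1.mul h.tendsto_deriv

lemma deriv_nonpos (hn : 3 ≤ n) (h : IsProfile n V W u u₁) (hV : HasCondV a b A V)
    (hW : HasCondW c d B W) (ha : 0 < a) (hc : 0 < c) {r : ℝ} (hr : r ∈ Ioo (0 : ℝ) 1) :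
    u₁ r ≤ 0 := by
  have h1 := le_of_hasDerivAt_nonneg_of_tendsto hr.1
    (fun s hs => h.hasDerivAt_flux hn ⟨hs.1, hs.2.trans_lt hr.2⟩) (fun s hs => ?_)
    (by simpa using h.tendsto_flux.neg)
  · have h2 := pow_pos hr.1 (n - 1)
    by_contra! h3
    nlinarith [mul_pos h2 h3]
  · have hs' : s ∈ Ico (0 : ℝ) 1 := ⟨hs.1.le, hs.2.trans_lt hr.2⟩
    have hu := h.pos s hs'
    have := hs.1
    have hVs : 0 < V s := ha.trans_le (hV.bounds s hs').1
    have hWs : 0 < W s := hc.trans_le (hW.bounds s hs').1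
    positivity

lemma antitoneOn (hn : 3 ≤ n) (h : IsProfile n V W u u₁) (hV : HasCondV a b A V)
    (hW : HasCondW c d B W) (ha : 0 < a) (hc : 0 < c) : AntitoneOn u (Icc 0 1) := by
  refine antitoneOn_of_deriv_nonpos (convex_Icc 0 1) h.cont ?_ ?_ <;> rw [interior_Icc]
  · exact fun r hr => (h.hasDerivAt r hr).differentiableAt.differentiableWithinAt
  · intro r hr
    rw [(h.hasDerivAt r hr).deriv]
    exact h.deriv_nonpos hn hV hW ha hc hr

/-- Since `u` decreases, the flux `-s^(n-1) u'` grows at rate at least `a s^(n-1)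
u(ρ)^((n+2)/(n-2))` on `(0, ρ]`; integrate from `0`. -/
lemma deriv_le (hn : 3 ≤ n) (h : IsProfile n V W u u₁) (hV : HasCondV a b A V)
    (hW : HasCondW c d B W) (ha : 0 < a) (hc : 0 < c) {ρ : ℝ} (hρ : ρ ∈ Ioo (0 : ℝ) 1) :
    u₁ ρ ≤ -(a / n * ρ * (u ρ ^ (4 / ((n : ℝ) - 2)) * u ρ)) := by
  have hn' := one_le_cast_sub_two hn
  have hn0 : (0 : ℝ) < n := by linarith
  set P : ℝ := u ρ ^ (4 / ((n : ℝ) - 2)) * u ρ with hP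
  have huρ := h.pos ρ (Ioo_subset_Ico_self hρ)
  have h1 := le_of_hasDerivAt_nonneg_of_tendsto (l := 0) hρ.1
    (fun s hs => (h.hasDerivAt_flux hn ⟨hs.1, hs.2.trans_lt hρ.2⟩).sub
      ((hasDerivAt_pow_of_ne_zero n hs.1.ne').const_mul (a / n * P))) (fun s hs => ?_) ?_
  · have h2 : ρ ^ n = ρ ^ (n - 1) * ρ := by rw [← pow_succ]; congr 1; omega
    have h3 := pow_pos hρ.1 (n - 1)
    simp only [Pi.sub_apply, h2] at h1
    by_contra! h4
    nlinarith [mul_lt_mul_of_pos_left h4 h3]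
  · have hs' : s ∈ Ico (0 : ℝ) 1 := ⟨hs.1.le, hs.2.trans_lt hρ.2⟩
    have hu := h.pos s hs'
    have hs0 := hs.1
    have hVs := (hV.bounds s hs').1
    have hWs : 0 < W s := hc.trans_le (hW.bounds s hs').1
    have hle : u ρ ≤ u s := h.antitoneOn hn hV hW ha hc (Ico_subset_Icc_self hs')
      (Ioo_subset_Icc_self hρ) hs.2
    have hPle : P ≤ u s ^ (4 / ((n : ℝ) - 2)) * u s :=
      mul_le_mul (Real.rpow_le_rpow huρ.le hle (by positivity)) hle huρ.le (by positivity)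
    have h2 : s ^ n = s ^ (n - 1) * s := by rw [← pow_succ]; congr 1; omega
    have h3 : a / n * P * (n / s * s ^ n) = s ^ (n - 1) * (a * P) := by
      rw [h2]; field_simp
    rw [h3, mul_assoc, ← mul_sub]
    refine mul_nonneg (by positivity) ?_
    have h4 : a * P ≤ V s * (u s ^ (4 / ((n : ℝ) - 2)) * u s) :=
      mul_le_mul hVs hPle (by positivity) (ha.le.trans hVs)
    nlinarith [mul_pos hWs hu]
  · have h2 : Tendsto (fun s : ℝ => a / n * P * s ^ n) (𝓝[>] 0) (𝓝 (a / n * P * 0 ^ n)) :=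
      (Continuous.tendsto (by fun_prop) 0).mono_left nhdsWithin_le_nhds
    have h3 := h.tendsto_flux.neg.sub h2
    rw [zero_pow (by omega)] at h3
    simpa [Pi.sub_def] using h3

/-- With `q = 4/(n-2)`, `deriv_le` reads `(u^(-q))' ≥ q a s / n`; integrating gives `u(ρ)^(-q) ≥ q a
ρ² / (2n)`. -/
lemma sq_mul_rpow_le (hn : 3 ≤ n) (h : IsProfile n V W u u₁) (hV : HasCondV a b A V)
    (hW : HasCondW c d B W) (ha : 0 < a) (hc : 0 < c) {ρ : ℝ} (hρ : ρ ∈ Ioo (0 : ℝ) 1) :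
    ρ ^ 2 * u ρ ^ (4 / ((n : ℝ) - 2)) ≤ n * ((n : ℝ) - 2) / (2 * a) := by
  have hn' := one_le_cast_sub_two hn
  have hn0 : (0 : ℝ) < n := by linarith
  set q : ℝ := 4 / ((n : ℝ) - 2) with hq
  have hq0 : 0 < q := by positivity
  have hu0 := h.pos 0 (by simp)
  have huρ := h.pos ρ (Ioo_subset_Ico_self hρ)
  have h1 := le_of_hasDerivAt_nonneg_of_tendsto (l := u 0 ^ (-q)) hρ.1
    (fun s hs => ((h.hasDerivAt s ⟨hs.1, hs.2.trans_lt hρ.2⟩).rpow_const (p := -q)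
      (Or.inl (h.pos s ⟨hs.1.le, hs.2.trans_lt hρ.2⟩).ne')).sub
      ((hasDerivAt_pow 2 s).const_mul (q * a / (2 * n)))) (fun s hs => ?_) ?_
  · have h2 : 0 < u 0 ^ (-q) := by positivity
    have h3 : q * a / (2 * n) * ρ ^ 2 ≤ u ρ ^ (-q) := by
      have := h2.le.trans h1
      simp only [Pi.sub_apply] at this
      linarith
    have h4 : u ρ ^ (-q) * u ρ ^ q = 1 := by
      rw [← Real.rpow_add huρ]; simp
    have h5 : q * a / (2 * n) * ρ ^ 2 * u ρ ^ q ≤ 1 := by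
      rw [← h4]; gcongr
    have h6 : q * a / (2 * n) = (n * ((n : ℝ) - 2) / (2 * a))⁻¹ := by
      rw [hq]; field_simp; ring
    rw [h6, mul_assoc, inv_mul_le_iff₀ (by positivity), mul_one] at h5
    exact h5
  · have hs' : s ∈ Ioo (0 : ℝ) 1 := ⟨hs.1, hs.2.trans_lt hρ.2⟩
    have hu := h.pos s (Ioo_subset_Ico_self hs')
    have h2 := h.deriv_le hn hV hW ha hc hs'
    have h3 : u s ^ (-q - 1) * (u s ^ q * u s) = 1 := by
      rw [← Real.rpow_add_one hu.ne', ← Real.rpow_add hu]; simp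
    have h4 : 0 < u s ^ (-q - 1) := by positivity
    have h5 := mul_le_mul_of_nonneg_left h2 (mul_pos hq0 h4).le
    have h6 : q * u s ^ (-q - 1) * -(a / n * s * (u s ^ q * u s)) = -(q * (a / n * s)) := by
      linear_combination (-(q * (a / n * s))) * h3
    rw [h6] at h5
    have h7 : q * a / (2 * n) * ((2 : ℕ) * s ^ (2 - 1)) = q * (a / n * s) := by
      push_cast; field_simp
    rw [h7]
    linarith
  · have h2 := (h.tendsto_zero.rpow_const (p := -q) (Or.inl hu0.ne'))
    have h3 : Tendsto (fun s : ℝ => q * a / (2 * n) * s ^ 2) (𝓝[>] 0) (𝓝 (q * a / (2 * n) * 0 ^ 2)) :=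
      (Continuous.tendsto (by fun_prop) 0).mono_left nhdsWithin_le_nhds
    simpa [Pi.sub_def] using h2.sub h3

end IsProfile

/-! ### The Pohozaev energy and its sign. -/

/-- The radial Pohozaev energy at radius `r`, with the value of `V` passed as the number `v`. -/
noncomputable def pohozaevEnergy (n : ℕ) (W u u₁ : ℝ → ℝ) (v r : ℝ) : ℝ :=
  r ^ n * (u₁ r ^ 2 / 2 + v * (((n : ℝ) - 2) / (2 * n)) * u r ^ (2 * (n : ℝ) / ((n : ℝ) - 2))
    + W r * u r ^ 2 / 2) + ((n : ℝ) - 2) / 2 * (r ^ (n - 1) * (u r * u₁ r))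

namespace IsProfile

variable {n : ℕ} {V W u u₁ : ℝ → ℝ} {a b c d A B : ℝ}

lemma hasDerivAt_rpow (hn : 3 ≤ n) (h : IsProfile n V W u u₁) {r : ℝ}
    (hr : r ∈ Ioo (0 : ℝ) 1) :
    HasDerivAt (fun s => u s ^ (2 * (n : ℝ) / ((n : ℝ) - 2)))
      (2 * n / ((n : ℝ) - 2) * (u r ^ (4 / ((n : ℝ) - 2)) * u r) * u₁ r) r := by
  have hn' := one_le_cast_sub_two hn
  have hu := h.pos r (Ioo_subset_Ico_self hr)
  refine ((h.hasDerivAt r hr).rpow_const (Or.inl hu.ne')).congr_deriv ?_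
  rw [← rpow_critical hn hu]
  have : 2 * (n : ℝ) / ((n : ℝ) - 2) - 1 = ((n : ℝ) + 2) / ((n : ℝ) - 2) := by
    field_simp; ring
  rw [this]
  ring

lemma hasDerivAt_pohozaevEnergy (hn : 3 ≤ n) (h : IsProfile n V W u u₁)
    (hW : HasCondW c d B W) {r : ℝ} (hr : r ∈ Ioo (0 : ℝ) 1) :
    HasDerivAt (pohozaevEnergy n W u u₁ (V r))
      (r ^ (n - 1) * u r ^ 2 * (W r + r * deriv W r / 2)) r := by
  have hn' := one_le_cast_sub_two hn
  have hn0 : (0 : ℝ) < n := by linarith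
  have hr0 := hr.1.ne'
  have hu := h.pos r (Ioo_subset_Ico_self hr)
  have hu' := h.hasDerivAt r hr
  have hu₁ := h.hasDerivAt_deriv' hn hr
  have h1 := (((hu₁.pow 2).div_const 2).add ((h.hasDerivAt_rpow hn hr).const_mul
    (V r * (((n : ℝ) - 2) / (2 * n))))).add (((hW.hasDerivAt hr).mul (hu'.pow 2)).div_const 2)
  have h2 := ((hasDerivAt_pow_of_ne_zero n hr0).mul h1).add
    (((hasDerivAt_pow_of_ne_zero (n - 1) hr0).mul (hu'.mul hu₁)).const_mul (((n : ℝ) - 2) / 2))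
  refine h2.congr_deriv ?_
  have h3 : r ^ n = r ^ (n - 1) * r := by rw [← pow_succ]; congr 1; omega
  simp only [Pi.add_apply, Pi.mul_apply, Pi.pow_apply]
  rw [h3, rpow_critical_add_one hn hu, Nat.cast_sub (by omega)]
  generalize u r ^ (4 / ((n : ℝ) - 2)) = X
  have hn2 : (n : ℝ) - 2 ≠ 0 := by linarith
  push_cast
  simp only [pow_one]
  field_simp
  ring

/-- Freeze `V` at `r`. Moving on to `s` costs at most `ε (s² - r²) κ g(s)`, and the frozen energy
minus this cost still has positive derivative at `s = r`. The threshold `ε` is chosen so that the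
loss is at most `c/4` times `r^(n-1) u²`, while `W + r W'/2 > c/2`. -/
lemma eventually_pohozaevEnergy_le (hn : 3 ≤ n) (h : IsProfile n V W u u₁)
    (hV : HasCondV a b A V) (hW : HasCondW c d B W) (ha : 0 < a) (hc : 0 < c)
    (hA : A ≤ a * c / (2 * ((n : ℝ) - 2) ^ 2)) (hB : B ≤ c) {r : ℝ} (hr : r ∈ Ioo (0 : ℝ) 1) :
    ∀ᶠ s in 𝓝[>] r, pohozaevEnergy n W u u₁ (V r) r ≤ pohozaevEnergy n W u u₁ (V s) s := by
  have hn' := one_le_cast_sub_two hn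
  have hn0 : (0 : ℝ) < n := by linarith
  have hr0 := hr.1
  have hu := h.pos r (Ioo_subset_Ico_self hr)
  set ε : ℝ := a * c / (2 * ((n : ℝ) - 2) ^ 2) with hε
  have hε0 : 0 < ε := by positivity
  set κ : ℝ := ((n : ℝ) - 2) / (2 * n) with hκ
  have hκ0 : 0 < κ := by positivity
  set g : ℝ → ℝ := fun s => s ^ n * u s ^ (2 * (n : ℝ) / ((n : ℝ) - 2)) with hg
  have hgc : HasDerivAt g _ r := (hasDerivAt_pow_of_ne_zero n hr0.ne').mul (h.hasDerivAt_rpow hn hr)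
  have hsq : HasDerivAt (fun s : ℝ => s ^ 2 - r ^ 2) (2 * r) r := by
    simpa using (hasDerivAt_pow 2 r).sub_const (r ^ 2)
  have hH := (h.hasDerivAt_pohozaevEnergy hn hW hr).sub ((hsq.mul hgc).const_mul (ε * κ))
  have hpos := hH.eventually_lt_of_pos ?_
  · filter_upwards [hpos, Ioo_mem_nhdsGT hr.2] with s hs hs1
    have hs' : s ∈ Ico (0 : ℝ) 1 := ⟨(hr0.trans hs1.1).le, hs1.2⟩
    have hlip := hV.lip s hs' r (Ioo_subset_Ico_self hr)
    have hsr : 0 ≤ s ^ 2 - r ^ 2 := by nlinarith [hs1.1]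
    rw [abs_of_nonneg hsr] at hlip
    have h1 : -(ε * (s ^ 2 - r ^ 2)) ≤ V s - V r := by
      have := (abs_le.1 hlip).1
      have := mul_le_mul_of_nonneg_right hA hsr
      linarith
    have hgs : 0 ≤ g s := by
      have := h.pos s hs'
      have := hs'.1
      positivity
    have h2 := mul_le_mul_of_nonneg_right h1 (mul_nonneg hκ0.le hgs)
    have h3 : pohozaevEnergy n W u u₁ (V s) s
        = pohozaevEnergy n W u u₁ (V r) s + (V s - V r) * (κ * g s) := by
      simp only [pohozaevEnergy, hg]
      ring
    simp only [Pi.sub_apply, Pi.mul_apply, sub_self, zero_mul, mul_zero, sub_zero] at hs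
    rw [h3]
    linarith
  · have h1 := h.sq_mul_rpow_le hn hV hW ha hc hr
    have hWb := (hW.bounds r (Ioo_subset_Ico_self hr)).1
    have hW' := (abs_le.1 ((hW.deriv_le r hr).trans hB)).1
    have h3 : r ^ n = r ^ (n - 1) * r := by rw [← pow_succ]; congr 1; omega
    have h4 : ε * κ * (2 * r * g r) = r ^ (n - 1) * u r ^ 2
        * (2 * ε * κ * (r ^ 2 * u r ^ (4 / ((n : ℝ) - 2)))) := by
      simp only [hg]
      rw [rpow_critical_add_one hn hu, h3]
      ring
    have h5 : 2 * ε * κ * (n * ((n : ℝ) - 2) / (2 * a)) = c / 4 := by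
      rw [hε, hκ]
      field_simp
      norm_num
    have h6 := mul_le_mul_of_nonneg_left h1 (by positivity : 0 ≤ 2 * ε * κ)
    rw [h5] at h6
    simp only [sub_self, zero_mul, add_zero]
    rw [h4, ← mul_sub]
    refine mul_pos (by positivity) ?_
    have h7 : -(c / 2) < r * deriv W r / 2 := by nlinarith [hr.2]
    linarith

lemma continuousOn_pohozaevEnergy (hn : 3 ≤ n) (h : IsProfile n V W u u₁)
    (hV : HasCondV a b A V) (hW : HasCondW c d B W) :
    ContinuousOn (fun s => pohozaevEnergy n W u u₁ (V s) s) (Ioo 0 1) := by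
  intro r hr
  have h1 := (h.hasDerivAt r hr).continuousAt
  have h2 := (h.hasDerivAt_deriv r hr).continuousAt
  have h3 := hV.continuousAt hr
  have h4 := (hW.hasDerivAt hr).continuousAt
  have h5 := (h.hasDerivAt_rpow hn hr).continuousAt
  unfold pohozaevEnergy
  exact ContinuousAt.continuousWithinAt (by fun_prop)

lemma pohozaevEnergy_nonneg (hn : 3 ≤ n) (h : IsProfile n V W u u₁)
    (hV : HasCondV a b A V) (hW : HasCondW c d B W) (ha : 0 < a) (hc : 0 < c)
    (hA : A ≤ a * c / (2 * ((n : ℝ) - 2) ^ 2)) (hB : B ≤ c) {r : ℝ} (hr : r ∈ Ioo (0 : ℝ) 1) :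
    0 ≤ pohozaevEnergy n W u u₁ (V r) r := by
  have hn' := one_le_cast_sub_two hn
  have hn0 : (0 : ℝ) < n := by linarith
  -- This is the only term of the energy that can be negative, and it vanishes at the origin.
  have hlim : Tendsto (fun s => ((n : ℝ) - 2) / 2 * (u s * (s ^ (n - 1) * u₁ s))) (𝓝[>] 0) (𝓝 0) := by
    simpa using (h.tendsto_zero.mul h.tendsto_flux).const_mul (((n : ℝ) - 2) / 2)
  refine le_of_tendsto hlim ?_
  filter_upwards [Ioc_mem_nhdsGT hr.1] with s hs
  have hs' : s ∈ Ico (0 : ℝ) 1 := ⟨hs.1.le, hs.2.trans_lt hr.2⟩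
  have h1 : pohozaevEnergy n W u u₁ (V s) s ≤ pohozaevEnergy n W u u₁ (V r) r := by
    refine ContinuousOn.le_of_eventually_le hs.2
      ((h.continuousOn_pohozaevEnergy hn hV hW).mono fun t ht =>
        ⟨hs.1.trans_le ht.1, ht.2.trans_lt hr.2⟩) fun t ht =>
      h.eventually_pohozaevEnergy_le hn hV hW ha hc hA hB
        ⟨hs.1.trans_le ht.1, ht.2.trans hr.2⟩
  refine le_trans ?_ h1
  have hu := h.pos s hs'
  have := hs.1
  have hVs : 0 < V s := ha.trans_le (hV.bounds s hs').1
  have hWs : 0 < W s := hc.trans_le (hW.bounds s hs').1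
  have h2 : 0 ≤ s ^ n * (u₁ s ^ 2 / 2 + V s * (((n : ℝ) - 2) / (2 * n))
      * u s ^ (2 * (n : ℝ) / ((n : ℝ) - 2)) + W s * u s ^ 2 / 2) := by positivity
  unfold pohozaevEnergy
  nlinarith

end IsProfile

/-! ### Riccati equation and differential inequality for the decay rate. -/

/-- The logarithmic decay rate `-r u'(r) / u(r)`. -/
noncomputable def decayRate (u u₁ : ℝ → ℝ) (r : ℝ) : ℝ := -(r * u₁ r / u r)

namespace IsProfile

variable {n : ℕ} {V W u u₁ : ℝ → ℝ} {a b c d A B : ℝ}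

lemma hasDerivAt_decayRate (hn : 3 ≤ n) (h : IsProfile n V W u u₁) {r : ℝ}
    (hr : r ∈ Ioo (0 : ℝ) 1) :
    HasDerivAt (decayRate u u₁) ((r ^ 2 * (V r * u r ^ (4 / ((n : ℝ) - 2)) + W r)
      - decayRate u u₁ r * ((n : ℝ) - 2 - decayRate u u₁ r)) / r) r := by
  have hu := h.pos r (Ioo_subset_Ico_self hr)
  have hr0 := hr.1.ne'
  refine (((hasDerivAt_id r).mul (h.hasDerivAt_deriv' hn hr)).div
    (h.hasDerivAt r hr) hu.ne').neg.congr_deriv ?_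
  simp only [decayRate, id, Pi.mul_apply]
  field_simp
  ring

lemma tendsto_decayRate (h : IsProfile n V W u u₁) :
    Tendsto (decayRate u u₁) (𝓝[>] 0) (𝓝 0) := by
  have h1 : Tendsto (fun s : ℝ => s) (𝓝[>] 0) (𝓝 0) := tendsto_id.mono_left nhdsWithin_le_nhds
  have h2 := ((h1.mul h.tendsto_deriv).div h.tendsto_zero (h.pos 0 (by simp)).ne').neg
  rw [show decayRate u u₁ = fun s => -(s * u₁ s / u s) from rfl]
  simpa using h2

lemma decayRate_mul_le (hn : 3 ≤ n) (h : IsProfile n V W u u₁)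
    (hV : HasCondV a b A V) (hW : HasCondW c d B W) (ha : 0 < a) (hc : 0 < c)
    (hA : A ≤ a * c / (2 * ((n : ℝ) - 2) ^ 2)) (hB : B ≤ c) {r : ℝ} (hr : r ∈ Ioo (0 : ℝ) 1) :
    decayRate u u₁ r * ((n : ℝ) - 2 - decayRate u u₁ r)
      ≤ r ^ 2 * (((n : ℝ) - 2) / n * (V r * u r ^ (4 / ((n : ℝ) - 2))) + W r) := by
  have hn' := one_le_cast_sub_two hn
  have hn0 : (0 : ℝ) < n := by linarith
  have hu := h.pos r (Ioo_subset_Ico_self hr)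
  have hr0 := hr.1
  have h1 := h.pohozaevEnergy_nonneg hn hV hW ha hc hA hB hr
  -- The energy factors through `r^(n-2) u²/2`; the substitution avoids truncated subtraction in the
  -- exponents.
  obtain ⟨m, rfl⟩ : ∃ m, n = m + 2 := ⟨n - 2, by omega⟩
  have h2 : pohozaevEnergy (m + 2) W u u₁ (V r) r = r ^ m * u r ^ 2 / 2 *
      (r ^ 2 * ((((m + 2 : ℕ) : ℝ) - 2) / (m + 2 : ℕ)
        * (V r * u r ^ (4 / (((m + 2 : ℕ) : ℝ) - 2))) + W r)
        - decayRate u u₁ r * (((m + 2 : ℕ) : ℝ) - 2 - decayRate u u₁ r)) := by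
    rw [pohozaevEnergy, rpow_critical_add_one hn hu, decayRate,
      show m + 2 - 1 = m + 1 by omega]
    field_simp
    ring
  rw [h2] at h1
  have h3 : 0 < r ^ m * u r ^ 2 / 2 := by positivity
  linarith [nonneg_of_mul_nonneg_right h1 h3]

lemma deriv_decayRate_bounds (hn : 3 ≤ n) (h : IsProfile n V W u u₁)
    (hV : HasCondV a b A V) (hW : HasCondW c d B W) (ha : 0 < a) (hc : 0 < c)
    (hA : A ≤ a * c / (2 * ((n : ℝ) - 2) ^ 2)) (hB : B ≤ c) {r : ℝ} (hr : r ∈ Ioo (0 : ℝ) 1) :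
    0 ≤ deriv (decayRate u u₁) r ∧
      decayRate u u₁ r * ((n : ℝ) - 2 - decayRate u u₁ r)
        ≤ ((n : ℝ) - 2) / 2 * (r * deriv (decayRate u u₁) r) + d * r ^ 2 := by
  have hn' := one_le_cast_sub_two hn
  have hn0 : (0 : ℝ) < n := by linarith
  have hu := h.pos r (Ioo_subset_Ico_self hr)
  have hr0 := hr.1
  have h1 := h.decayRate_mul_le hn hV hW ha hc hA hB hr
  rw [(h.hasDerivAt_decayRate hn hr).deriv]
  have hVr : 0 < V r := ha.trans_le (hV.bounds r (Ioo_subset_Ico_self hr)).1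
  have hWr := (hW.bounds r (Ioo_subset_Ico_self hr)).2
  set Z : ℝ := V r * u r ^ (4 / ((n : ℝ) - 2)) with hZ
  have hZ0 : 0 < Z := by positivity
  set y := decayRate u u₁ r
  constructor
  · refine div_nonneg ?_ hr0.le
    have h2 : ((n : ℝ) - 2) / n * Z ≤ Z := by
      refine mul_le_of_le_one_left hZ0.le ?_
      rw [div_le_one hn0]
      linarith
    nlinarith [mul_le_mul_of_nonneg_left h2 (sq_nonneg r)]
  · rw [mul_div_cancel₀ _ hr0.ne']
    -- Scaled by `n/2`, the energy bound has the same `Z` coefficient as `(n-2)/2` times the Riccati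
    -- equation, so `Z` cancels.
    have h2 := mul_le_mul_of_nonneg_left h1 (by positivity : 0 ≤ (n : ℝ) / 2)
    have h3 : (n : ℝ) / 2 * (r ^ 2 * (((n : ℝ) - 2) / n * Z + W r))
        = r ^ 2 * (((n : ℝ) - 2) / 2 * Z + n / 2 * W r) := by
      field_simp
    rw [h3] at h2
    nlinarith [mul_le_mul_of_nonneg_left hWr (sq_nonneg r)]

lemma decayRate_monotoneOn (hn : 3 ≤ n) (h : IsProfile n V W u u₁)
    (hV : HasCondV a b A V) (hW : HasCondW c d B W) (ha : 0 < a) (hc : 0 < c)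
    (hA : A ≤ a * c / (2 * ((n : ℝ) - 2) ^ 2)) (hB : B ≤ c) :
    MonotoneOn (decayRate u u₁) (Ioo 0 1) := by
  refine monotoneOn_of_deriv_nonneg (convex_Ioo 0 1)
    (fun r hr => (h.hasDerivAt_decayRate hn hr).continuousAt.continuousWithinAt) ?_ ?_ <;>
    rw [interior_Ioo]
  · exact fun r hr => (h.hasDerivAt_decayRate hn hr).differentiableAt.differentiableWithinAt
  · exact fun r hr => (h.deriv_decayRate_bounds hn hV hW ha hc hA hB hr).1

/-! ### Logarithmic estimates on both sides of the radius where the decay rate is `(n-2)/2`. -/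

lemma hasDerivAt_log (h : IsProfile n V W u u₁) {r : ℝ} (hr : r ∈ Ioo (0 : ℝ) 1) :
    HasDerivAt (fun s => Real.log (u s)) (-(decayRate u u₁ r / r)) r := by
  have hu := h.pos r (Ioo_subset_Ico_self hr)
  have hr0 := hr.1.ne'
  refine ((h.hasDerivAt r hr).log hu.ne').congr_deriv ?_
  rw [decayRate]
  field_simp

/-- Here `N - y ≥ N/2`, so the differential inequality gives `-(log u)' = y/s ≤ y' + (2d/N) s`,
whose right side is an exact derivative. -/
lemma log_zero_le (hn : 3 ≤ n) (h : IsProfile n V W u u₁)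
    (hV : HasCondV a b A V) (hW : HasCondW c d B W) (ha : 0 < a) (hc : 0 < c)
    (hA : A ≤ a * c / (2 * ((n : ℝ) - 2) ^ 2)) (hB : B ≤ c) {ρ : ℝ} (hρ : ρ ∈ Ioo (0 : ℝ) 1)
    (hy : decayRate u u₁ ρ ≤ ((n : ℝ) - 2) / 2) :
    Real.log (u 0) ≤ Real.log (u ρ) + ((n : ℝ) - 2) / 2 + d / ((n : ℝ) - 2) * ρ ^ 2 := by
  have hn' := one_le_cast_sub_two hn
  have hsub : ∀ s ∈ Ioc 0 ρ, s ∈ Ioo (0 : ℝ) 1 := fun s hs => ⟨hs.1, hs.2.trans_lt hρ.2⟩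
  have h1 := le_of_hasDerivAt_nonneg_of_tendsto (l := Real.log (u 0)) hρ.1
    (fun s hs => ((h.hasDerivAt_log (hsub s hs)).add
      (h.hasDerivAt_decayRate hn (hsub s hs)).differentiableAt.hasDerivAt).add
      ((hasDerivAt_pow 2 s).const_mul (d / ((n : ℝ) - 2)))) (fun s hs => ?_) ?_
  · simp only [Pi.add_apply] at h1
    linarith
  · have hs0 := hs.1
    obtain ⟨h2, h3⟩ := h.deriv_decayRate_bounds hn hV hW ha hc hA hB (hsub s hs)
    have hys : decayRate u u₁ s ≤ ((n : ℝ) - 2) / 2 :=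
      (h.decayRate_monotoneOn hn hV hW ha hc hA hB (hsub s hs) hρ hs.2).trans hy
    have hys0 : 0 ≤ decayRate u u₁ s := by
      have hu := h.pos s (Ioo_subset_Ico_self (hsub s hs))
      have h4 := h.deriv_nonpos hn hV hW ha hc (hsub s hs)
      rw [decayRate, ← neg_div]
      exact div_nonneg (by nlinarith) hu.le
    generalize deriv (decayRate u u₁) s = y' at h2 h3 ⊢
    generalize decayRate u u₁ s = y at hys hys0 h3 ⊢
    have h5 : y * (((n : ℝ) - 2) / 2) ≤ ((n : ℝ) - 2) / 2 * (s * y') + d * s ^ 2 := by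
      nlinarith
    have h6 : -(y / s) + y' + d / ((n : ℝ) - 2) * ((2 : ℕ) * s ^ (2 - 1))
        = (((n : ℝ) - 2) / 2 * (s * y') + d * s ^ 2 - y * (((n : ℝ) - 2) / 2))
          / (s * (((n : ℝ) - 2) / 2)) := by
      push_cast
      field_simp
      ring
    rw [h6]
    exact div_nonneg (by linarith) (by positivity)
  · have h2 : Tendsto (fun s : ℝ => d / ((n : ℝ) - 2) * s ^ 2) (𝓝[>] 0)
        (𝓝 (d / ((n : ℝ) - 2) * 0 ^ 2)) :=
      (Continuous.tendsto (by fun_prop) 0).mono_left nhdsWithin_le_nhds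
    have h3 := ((h.tendsto_zero.log (h.pos 0 (by simp)).ne').add h.tendsto_decayRate).add h2
    simpa [Pi.add_def] using h3

/-- The derivative of `log (s^N u)` is `(N - y)/s`, and for `y ≥ N/2` it is at most `(N²/2) y'/y² +
(2d/N) s`. The first term integrates to at most `N`, however large `y` becomes. -/
lemma log_pow_mul_le (hn : 3 ≤ n) (h : IsProfile n V W u u₁)
    (hV : HasCondV a b A V) (hW : HasCondW c d B W) (ha : 0 < a) (hc : 0 < c) (hd : 0 < d)
    (hA : A ≤ a * c / (2 * ((n : ℝ) - 2) ^ 2)) (hB : B ≤ c) {r ρ : ℝ} (hr : 0 < r) (hrρ : r ≤ ρ)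
    (hρ : ρ < 1) (hy : decayRate u u₁ r = ((n : ℝ) - 2) / 2) :
    ((n : ℝ) - 2) * Real.log ρ + Real.log (u ρ)
      ≤ ((n : ℝ) - 2) * Real.log r + Real.log (u r) + ((n : ℝ) - 2)
        + d / ((n : ℝ) - 2) * ρ ^ 2 := by
  have hn' := one_le_cast_sub_two hn
  set N : ℝ := (n : ℝ) - 2 with hN
  have hsub : ∀ s ∈ Icc r ρ, s ∈ Ioo (0 : ℝ) 1 :=
    fun s hs => ⟨hr.trans_le hs.1, hs.2.trans_lt hρ⟩
  have hys : ∀ s ∈ Icc r ρ, N / 2 ≤ decayRate u u₁ s := fun s hs => hy ▸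
    h.decayRate_monotoneOn hn hV hW ha hc hA hB (hsub r ⟨le_rfl, hrρ⟩) (hsub s hs) hs.1
  set F : ℝ → ℝ := fun s => N * Real.log s + Real.log (u s) + N ^ 2 / 2 * (decayRate u u₁ s)⁻¹
    - d / N * s ^ 2 with hF
  have hder : ∀ s ∈ Icc r ρ, HasDerivAt F (N * s⁻¹ + -(decayRate u u₁ s / s)
      + N ^ 2 / 2 * (-deriv (decayRate u u₁) s / decayRate u u₁ s ^ 2)
      - d / N * ((2 : ℕ) * s ^ (2 - 1))) s := by
    intro s hs
    have hs0 := (hsub s hs).1.ne'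
    have hys0 : decayRate u u₁ s ≠ 0 := by have := hys s hs; linarith
    exact ((((Real.hasDerivAt_log hs0).const_mul N).add (h.hasDerivAt_log (hsub s hs))).add
      (((h.hasDerivAt_decayRate hn (hsub s hs)).differentiableAt.hasDerivAt.inv hys0).const_mul
        (N ^ 2 / 2))).sub ((hasDerivAt_pow 2 s).const_mul (d / N))
  have hanti : AntitoneOn F (Icc r ρ) := by
    refine antitoneOn_of_deriv_nonpos (convex_Icc r ρ)
      (fun s hs => (hder s hs).continuousAt.continuousWithinAt)
      (fun s hs => (hder s (interior_subset hs)).differentiableAt.differentiableWithinAt)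
      fun s hs => ?_
    replace hs := interior_subset hs
    rw [(hder s hs).deriv]
    have hs0 := (hsub s hs).1
    obtain ⟨h2, h3⟩ := h.deriv_decayRate_bounds hn hV hW ha hc hA hB (hsub s hs)
    have hyk := hys s hs
    rw [← hN] at h3
    generalize deriv (decayRate u u₁) s = y' at h2 h3 ⊢
    generalize decayRate u u₁ s = y at hyk h3 ⊢
    have hy0 : 0 < y := by linarith
    have h4 : N - y ≤ N ^ 2 / 2 * (s * y') / y ^ 2 + 2 * d / N * s ^ 2 := by
      -- For `y ≥ N` the left side is nonpositive; for `y ≤ N` divide the inequality by `y` and use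
      -- `1/y ≤ N/y²`.
      rcases le_total N y with hNy | hNy
      · have : 0 ≤ N ^ 2 / 2 * (s * y') / y ^ 2 + 2 * d / N * s ^ 2 := by positivity
        linarith
      · have h5 : N - y ≤ N / 2 * (s * y') / y + d * s ^ 2 / y := by
          rw [← add_div, le_div_iff₀ hy0]
          linarith
        have h6 : N / 2 * (s * y') / y ≤ N ^ 2 / 2 * (s * y') / y ^ 2 := by
          rw [div_le_div_iff₀ hy0 (by positivity)]
          have : 0 ≤ N / 2 * (s * y') * y := by positivity
          nlinarith
        have h7 : d * s ^ 2 / y ≤ 2 * d / N * s ^ 2 := by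
          rw [div_le_iff₀ hy0]
          have h8 : 2 * d / N * s ^ 2 * (N / 2) = d * s ^ 2 := by field_simp
          have h9 : 0 ≤ 2 * d / N * s ^ 2 := by positivity
          nlinarith
        linarith
    have h5 : N * s⁻¹ + -(y / s) + N ^ 2 / 2 * (-y' / y ^ 2) - d / N * ((2 : ℕ) * s ^ (2 - 1))
        = ((N - y) - (N ^ 2 / 2 * (s * y') / y ^ 2 + 2 * d / N * s ^ 2)) / s := by
      push_cast
      field_simp
      ring
    rw [h5]
    exact div_nonpos_of_nonpos_of_nonneg (by linarith) hs0.le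
  have h1 := hanti (left_mem_Icc.2 hrρ) (right_mem_Icc.2 hrρ) hrρ
  simp only [hF] at h1
  rw [hy] at h1
  have h2 : N ^ 2 / 2 * (N / 2)⁻¹ = N := by field_simp
  have h3 : 0 ≤ N ^ 2 / 2 * (decayRate u u₁ ρ)⁻¹ := by
    have : 0 < decayRate u u₁ ρ := by have := hys ρ (right_mem_Icc.2 hrρ); linarith
    positivity
  have h4 : 0 ≤ d / N * r ^ 2 := by positivity
  linarith

lemma log_scale_le (hn : 3 ≤ n) (h : IsProfile n V W u u₁) (hV : HasCondV a b A V)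
    (hW : HasCondW c d B W) (ha : 0 < a) (hc : 0 < c) {r : ℝ} (hr : r ∈ Ioo (0 : ℝ) 1) :
    ((n : ℝ) - 2) * Real.log r + 2 * Real.log (u r)
      ≤ ((n : ℝ) - 2) / 2 * Real.log (n * ((n : ℝ) - 2) / (2 * a)) := by
  have hn' := one_le_cast_sub_two hn
  have hu := h.pos r (Ioo_subset_Ico_self hr)
  have hr0 := hr.1
  have h1 := Real.log_le_log (by positivity) (h.sq_mul_rpow_le hn hV hW ha hc hr)
  rw [Real.log_mul (by positivity) (by positivity), Real.log_pow, Real.log_rpow hu] at h1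
  refine le_trans (le_of_eq ?_) (mul_le_mul_of_nonneg_left h1 (by linarith))
  push_cast
  field_simp
  ring

lemma log_add_log_le (hn : 3 ≤ n) (h : IsProfile n V W u u₁)
    (hV : HasCondV a b A V) (hW : HasCondW c d B W) (ha : 0 < a) (hc : 0 < c) (hd : 0 < d)
    (hA : A ≤ a * c / (2 * ((n : ℝ) - 2) ^ 2)) (hB : B ≤ c) {ρ : ℝ} (hρ : ρ ∈ Ioo (0 : ℝ) 1) :
    Real.log (u 0) + Real.log (u ρ)
      ≤ ((n : ℝ) - 2) / 2 * Real.log (n * ((n : ℝ) - 2) / (2 * a)) + 3 / 2 * ((n : ℝ) - 2)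
        + 2 * (d / ((n : ℝ) - 2)) - ((n : ℝ) - 2) * Real.log ρ := by
  have hn' := one_le_cast_sub_two hn
  have hN0 : (0 : ℝ) < ((n : ℝ) - 2) / 2 := by linarith
  have hdN : 0 ≤ d / ((n : ℝ) - 2) := by positivity
  have hsq : ∀ s ∈ Ioo (0 : ℝ) 1, d / ((n : ℝ) - 2) * s ^ 2 ≤ d / ((n : ℝ) - 2) := fun s hs =>
    mul_le_of_le_one_right hdN (pow_le_one₀ hs.1.le hs.2.le)
  rcases le_total (decayRate u u₁ ρ) (((n : ℝ) - 2) / 2) with hy | hy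
  · have h1 := h.log_zero_le hn hV hW ha hc hA hB hρ hy
    have h2 := h.log_scale_le hn hV hW ha hc hρ
    have h3 := hsq ρ hρ
    linarith
  -- The rate tends to `0` at the origin, so it crosses `(n-2)/2` at some `r ≤ ρ`.
  · obtain ⟨s, hs, hsρ⟩ := ((h.tendsto_decayRate.eventually_lt_const hN0).and
      (Ioo_mem_nhdsGT hρ.1)).exists
    have hcont : ContinuousOn (decayRate u u₁) (Icc s ρ) := fun t ht =>
      (h.hasDerivAt_decayRate hn
        ⟨hsρ.1.trans_le ht.1, ht.2.trans_lt hρ.2⟩).continuousAt.continuousWithinAt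
    obtain ⟨r, hr, hyr⟩ := intermediate_value_Icc hsρ.2.le hcont ⟨hs.le, hy⟩
    have hr' : r ∈ Ioo (0 : ℝ) 1 := ⟨hsρ.1.trans_le hr.1, hr.2.trans_lt hρ.2⟩
    have h1 := h.log_zero_le hn hV hW ha hc hA hB hr' hyr.le
    have h2 := h.log_scale_le hn hV hW ha hc hr'
    have h3 := h.log_pow_mul_le hn hV hW ha hc hd hA hB hr'.1 hr.2 hρ.2 hyr
    have h4 := hsq ρ hρ
    have h5 := hsq r hr'
    linarith

end IsProfile

theorem mainTheorem2 (n : ℕ) (hn : 3 ≤ n) (a b c d : ℝ)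
    (ha : 0 < a) (hb : 0 < b) (hc : 0 < c) (hd : 0 < d)
    (A B : ℕ → ℝ)
    (hA : Filter.Tendsto A Filter.atTop (nhds 0))
    (hB : Filter.Tendsto B Filter.atTop (nhds 0)) :
    ∃ C : ℝ, 0 < C ∧ ∃ i₀ : ℕ, ∀ V W u : ℕ → ℝ → ℝ,
      (∀ i, HasCondV a b (A i) (V i)) →
      (∀ i, HasCondW c d (B i) (W i)) →
      (∀ i, IsRadialSolution n (V i) (W i) (u i)) →
      ∀ i, i₀ ≤ i → u i 0 * u i 1 ≤ C := by
  have hn' := one_le_cast_sub_two hn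
  have hε : 0 < a * c / (2 * ((n : ℝ) - 2) ^ 2) := by positivity
  obtain ⟨i₀, hi₀⟩ := Filter.eventually_atTop.1
    ((hA.eventually_le_const hε).and (hB.eventually_le_const hc))
  refine ⟨_, Real.exp_pos (((n : ℝ) - 2) / 2 * Real.log (n * ((n : ℝ) - 2) / (2 * a))
    + 3 / 2 * ((n : ℝ) - 2) + 2 * (d / ((n : ℝ) - 2)) - ((n : ℝ) - 2) * Real.log (1 / 2)), i₀,
    fun V W u hV hW hu i hi => ?_⟩
  obtain ⟨hAi, hBi⟩ := hi₀ i hi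
  obtain ⟨u₁, h⟩ := (hu i).exists_isProfile hn
  -- Any fixed radius in `(0, 1)` would do; the equation is not available at `r = 1`, which
  -- monotonicity then reaches.
  have hρ : (1 / 2 : ℝ) ∈ Ioo (0 : ℝ) 1 := by norm_num
  have h0 := h.pos 0 (by simp)
  have h1 := h.pos _ (Ioo_subset_Ico_self hρ)
  have h2 := h.log_add_log_le hn (hV i) (hW i) ha hc hd hAi hBi hρ
  have h3 := h.antitoneOn hn (hV i) (hW i) ha hc (Ioo_subset_Icc_self hρ)
    (right_mem_Icc.2 zero_le_one) hρ.2.le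
  rw [← Real.log_mul h0.ne' h1.ne', Real.log_le_iff_le_exp (mul_pos h0 h1)] at h2
  exact (mul_le_mul_of_nonneg_left h3 h0.le).trans h2
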